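/- Let $\mathbb F$ be a field (finite or infinite) of characteristic different from $2$. Let $E^1$ be the Grassmann algebra with identity element $1$ over $\mathbb F$, generated by $e_1,e_2,\ldots$ with relations $e_ie_j=-e_je_i$ and $e_i^2=0$; let $E_0^1$ be the span of its elements of even length (including $1$) and $E_1$ the span of its elements of odd length. Let $M_{1,1}(E^1)$ be the algebra of all matrices $\begin{pmatrix} a & b\\ d & c\end{pmatrix}$ with $a,c\in E_0^1$ and $b,d\in E_1$, regarded as a Lie algebra over $\mathbb F$ with $[A,B]=AB-BA$. Let $L(X)$ be the free Lie algebra over $\mathbb F$ on the countable set $X=\{x_1,x_2,\ldots\}$. An element $f\in L(X)$ is called multihomogeneous if it is a linear combination of Lie monomials that all have the same degree in each variable; it is an identity of a Lie algebra $A$ if $f(a_1,a_2,\ldots)=0$ for all $a_1,a_2,\ldots\in A$; and it is a consequence of $g\in L(X)$ if it lies in the ideal of $L(X)$ generated by all elements obtained from $g$ by substituting elements of $L(X)$ for the variables. Then every multihomogeneous identity $f$ of the Lie algebra $M_{1,1}(E^1)$ is a consequence of the identity $[x,y,[z,t],u]=0$, that is, of the polynomial $[[[x,y],[z,t]],u]$,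 where $x,y,z,t,u$ are distinct variables. -/

import Mathlib

/- Every associative algebra `A` is regarded as its adjoint Lie algebra, with `⁅a, b⁆ = a * b - b * a`. -/
attribute [local instance 100] LieRing.ofAssociativeRing

noncomputable section

/-- The Grassmann algebra with identity element `E¹` over `F`: the exterior algebra of a vector
space with countable basis `e 0, e 1, …`. -/
abbrev GrassmannOne (F : Type*) [Field F] : Type _ := ExteriorAlgebra F (ℕ →₀ F)

namespace GrassmannOne

variable (F : Type*) [Field F]

/-- The span of the elements of even length, including `1`. -/
def even : Submodule F (GrassmannOne F) :=
  CliffordAlgebra.evenOdd (0 : QuadraticForm F (ℕ →₀ F)) 0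

/-- The span of the elements of odd length. -/
def odd : Submodule F (GrassmannOne F) :=
  CliffordAlgebra.evenOdd (0 : QuadraticForm F (ℕ →₀ F)) 1

variable {F}

theorem mul_mem_even_of_even {a b : GrassmannOne F} (ha : a ∈ even F) (hb : b ∈ even F) :
    a * b ∈ even F :=
  CliffordAlgebra.evenOdd_mul_le _ 0 0 (Submodule.mul_mem_mul ha hb)

theorem mul_mem_even_of_odd {a b : GrassmannOne F} (ha : a ∈ odd F) (hb : b ∈ odd F) :
    a * b ∈ even F :=
  CliffordAlgebra.evenOdd_mul_le _ 1 1 (Submodule.mul_mem_mul ha hb)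

theorem even_mul_odd_mem {a b : GrassmannOne F} (ha : a ∈ even F) (hb : b ∈ odd F) :
    a * b ∈ odd F :=
  CliffordAlgebra.evenOdd_mul_le _ 0 1 (Submodule.mul_mem_mul ha hb)

theorem odd_mul_even_mem {a b : GrassmannOne F} (ha : a ∈ odd F) (hb : b ∈ even F) :
    a * b ∈ odd F :=
  CliffordAlgebra.evenOdd_mul_le _ 1 0 (Submodule.mul_mem_mul ha hb)

theorem algebraMap_mem_even (r : F) : algebraMap F (GrassmannOne F) r ∈ even F :=
  CliffordAlgebra.one_le_evenOdd_zero _ (Submodule.algebraMap_mem r)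

end GrassmannOne

open GrassmannOne in
/-- The algebra `M_{1,1}(E¹)` of the `2 × 2` matrices over `E¹` with even diagonal entries and odd
off-diagonal entries. -/
def M11 (F : Type*) [Field F] : Subalgebra F (Matrix (Fin 2) (Fin 2) (GrassmannOne F)) where
  carrier := {A | A 0 0 ∈ even F ∧ A 0 1 ∈ odd F ∧ A 1 0 ∈ odd F ∧ A 1 1 ∈ even F}
  add_mem' := by
    rintro A B ⟨h1, h2, h3, h4⟩ ⟨k1, k2, k3, k4⟩
    exact ⟨add_mem h1 k1, add_mem h2 k2, add_mem h3 k3, add_mem h4 k4⟩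
  mul_mem' := by
    rintro A B ⟨h1, h2, h3, h4⟩ ⟨k1, k2, k3, k4⟩
    simp only [Set.mem_ofPred_eq, Matrix.mul_apply, Fin.sum_univ_two]
    exact ⟨add_mem (mul_mem_even_of_even h1 k1) (mul_mem_even_of_odd h2 k3),
      add_mem (even_mul_odd_mem h1 k2) (odd_mul_even_mem h2 k4),
      add_mem (odd_mul_even_mem h3 k1) (even_mul_odd_mem h4 k3),
      add_mem (mul_mem_even_of_odd h3 k2) (mul_mem_even_of_even h4 k4)⟩
  algebraMap_mem' := by
    intro r
    simp [Matrix.algebraMap_eq_diagonal, algebraMap_mem_even]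

/-- Lie polynomials: the elements of the free Lie algebra on the variables `x 0, x 1, …`. -/
abbrev LiePoly (F : Type*) [Field F] : Type _ := FreeLieAlgebra F ℕ

namespace LiePoly

variable {F : Type*} [Field F]

/-- `f = 0` is an identity of the Lie algebra `L`: it holds under every substitution of elements of
`L` for the variables. -/
def IsIdentity (f : LiePoly F) (L : Type*) [LieRing L] [LieAlgebra F L] : Prop :=
  ∀ a : ℕ → L, FreeLieAlgebra.lift F a f = 0

/-- The Lie monomial obtained from a bracketed word in the variables. -/
def monomial (F : Type*) [Field F] : FreeMagma ℕ → LiePoly F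
  | .of i => FreeLieAlgebra.of F i
  | .mul u v => ⁅monomial F u, monomial F v⁆

/-- The multidegree of a bracketed word: `multidegree w i` is the number of times that the variable
`x i` occurs in `w`. -/
def multidegree : FreeMagma ℕ → ℕ →₀ ℕ
  | .of i => Finsupp.single i 1
  | .mul u v => multidegree u + multidegree v

/-- A Lie polynomial is multihomogeneous if it is a linear combination of Lie monomials that all
have the same degree in every variable. -/
def IsMultihomogeneous (f : LiePoly F) : Prop :=
  ∃ d : ℕ →₀ ℕ, f ∈ Submodule.span F (monomial F '' {w | multidegree w = d})

/-- The T-ideal generated by `g`: the smallest ideal of the free Lie algebra that contains all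
the polynomials obtained from `g` by substituting Lie polynomials for the variables. -/
def tIdeal (g : LiePoly F) : LieIdeal F (LiePoly F) :=
  LieSubmodule.lieSpan F (LiePoly F)
    (Set.range fun s : ℕ → LiePoly F => FreeLieAlgebra.lift F s g)

/-- The identity `f = 0` is a consequence of the identity `g = 0`. -/
def IsConsequenceOf (f g : LiePoly F) : Prop := f ∈ tIdeal g

/-- The left-normed polynomial `[x, y, [z, t], u]` in five distinct variables. -/
def centreByMetabelian (F : Type*) [Field F] : LiePoly F :=
  let x := FreeLieAlgebra.of F 0
  let y := FreeLieAlgebra.of F 1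
  let z := FreeLieAlgebra.of F 2
  let t := FreeLieAlgebra.of F 3
  let u := FreeLieAlgebra.of F 4
  ⁅⁅⁅x, y⁆, ⁅z, t⁆⁆, u⁆

end LiePoly

end

/-! ### Difference functions from a base point -/

section Cocycle

variable {F : Type*} [Field F]

/-! One substitution suffices: send `x i` to the matrix with diagonal `1, -1` and fresh odd
generators off the diagonal. Let `Q` be the free Lie algebra modulo the T-ideal; the map `ψ` it
induces on `Q` is shown to kill no nonzero multihomogeneous element. As no linearisation or scaling
of variables occurs, the field may be finite.

Apart from multiples of a variable, a multihomogeneous element of `Q` of letters `d` lies in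
`metaSpan + sqSpan`, where `sqSpan` is central. Each layer is detected by duality. A functional
vanishing on `sqSpan` depends, by the Jacobi identity, on a commutator only through a difference `g
j - g i`; the `(0, 1)` entry of `ψ`, which kills `sqSpan`, realises it up to a power of 2
(`mem_sqSpan_of_mem_metaSpan`). A functional restricted to `sqSpan` is a form skew in two pairs of
letters, and a cocycle computation (`exists_bilin_of_invariant_form`) derives it from one bilinear
function `g`; a functional on products of two generators, applied to the `(0, 0)` entry, realises it
(`eq_zero_of_mem_sqSpan`). Characteristic not 2 makes these powers of 2 invertible. -/

theorem exists_sub_eq_of_cocycle (S : Set ℕ) (T : ℕ → ℕ → F) (h0 : ∀ i, T i i = 0)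
    (hs : ∀ i j, T j i = -T i j)
    (hc : ∀ i ∈ S, ∀ j ∈ S, ∀ k ∈ S, i ≠ j → j ≠ k → i ≠ k → T i j + T j k + T k i = 0) :
    ∃ g : ℕ → F, ∀ i ∈ S, ∀ j ∈ S, T i j = g j - g i := by
  rcases S.eq_empty_or_nonempty with rfl | ⟨o, ho⟩
  · exact ⟨0, by simp⟩
  -- The potential is `T` measured from a base point `o`; coincidences with `o` need only skewness.
  refine ⟨T o, fun i hi j hj => ?_⟩
  by_cases hio : i = o
  · subst hio; simp [h0]
  by_cases hjo : j = o
  · subst hjo; rw [h0, hs]; simp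
  by_cases hij : i = j
  · subst hij; simp [h0]
  have h := hc o ho i hi j hj (Ne.symm hio) hij (Ne.symm hjo)
  rw [hs o j] at h
  linear_combination h

/-- An element of a multiset, chosen as a function of the multiset. -/
noncomputable def Multiset.someElt (s : Multiset ℕ) : ℕ := by
  classical exact if h : ∃ a, a ∈ s then h.choose else 0

theorem Multiset.someElt_mem {s : Multiset ℕ} {a : ℕ} (h : a ∈ s) : s.someElt ∈ s := by
  have h' : ∃ a, a ∈ s := ⟨a, h⟩
  rw [Multiset.someElt, dif_pos h']
  exact h'.choose_spec

/-! ### Room for extra letters in a multidegree -/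

theorem Multiset.mem_sub_iff_cons_le {s d : Multiset ℕ} (h : s ≤ d) (a : ℕ) :
    a ∈ d - s ↔ a ::ₘ s ≤ d := by
  rw [← Multiset.count_pos, Multiset.count_sub, Multiset.le_iff_count]
  rw [Multiset.le_iff_count] at h
  constructor
  · intro ha b
    have := h b
    rw [Multiset.count_cons]
    split_ifs with hb
    · subst hb; omega
    · omega
  · intro hb
    have := hb a
    rw [Multiset.count_cons_self] at this
    omega

theorem Multiset.cons_cons_le {s d : Multiset ℕ} {a b : ℕ} (ha : a ::ₘ s ≤ d) (hb : b ::ₘ s ≤ d)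
    (hab : a ≠ b) : a ::ₘ b ::ₘ s ≤ d := by
  rw [Multiset.le_iff_count] at *
  intro c
  have h1 := ha c
  have h2 := hb c
  rw [Multiset.count_cons] at *
  rw [Multiset.count_cons]
  split_ifs at * <;> omega

theorem Multiset.cons_le_of_mem_of_notMem {s d : Multiset ℕ} {a : ℕ} (ha : a ∈ d) (has : a ∉ s)
    (hs : s ≤ d) : a ::ₘ s ≤ d := by
  rw [← Multiset.mem_sub_iff_cons_le hs, ← Multiset.count_pos, Multiset.count_sub,
    Multiset.count_eq_zero_of_notMem has, tsub_zero]
  exact Multiset.count_pos.2 ha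

theorem Multiset.cons_cons_cons_le {s d : Multiset ℕ} {a b c : ℕ} (ha : a ::ₘ s ≤ d)
    (hb : b ::ₘ s ≤ d) (hc : c ::ₘ s ≤ d) (hab : a ≠ b) (hbc : b ≠ c) (hac : a ≠ c) :
    a ::ₘ b ::ₘ c ::ₘ s ≤ d := by
  have h1 := Multiset.cons_cons_le ha hc hac
  have h2 := Multiset.cons_cons_le hb hc hbc
  exact Multiset.cons_cons_le h1 h2 hab

theorem Multiset.le_of_count_le {s t d : Multiset ℕ} (h : s ≤ d)
    (hts : ∀ b, t.count b ≤ s.count b := by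
      intro b
      simp only [Multiset.insert_eq_cons, Multiset.count_cons, Multiset.count_singleton]
      omega) : t ≤ d :=
  (Multiset.le_iff_count.2 hts).trans h

open Multiset in
/-- The structure of the invariant skew forms on a multihomogeneous component of the free
metabelian algebra: each of them comes from a bilinear form on the variables. -/
theorem exists_bilin_of_invariant_form (d : Multiset ℕ) (hd : 4 ≤ card d) (T : ℕ → ℕ → ℕ → ℕ → F)
    (h0 : ∀ i k l, T i i k l = 0) (h0' : ∀ i j k, T i j k k = 0)
    (hs : ∀ i j k l, T j i k l = -T i j k l) (hs' : ∀ i j k l, T i j l k = -T i j k l)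
    (h4 : card d = 4 → ∀ i j k l, ({i, j, k, l} : Multiset ℕ) ≤ d → T k l i j = -T i j k l)
    (hc : ∀ i j k r s, ({i, j, k, r, s} : Multiset ℕ) ≤ d →
      T i j r s + T j k r s + T k i r s = 0)
    (hc' : ∀ i j k r s, ({i, j, k, r, s} : Multiset ℕ) ≤ d →
      T r s i j + T r s j k + T r s k i = 0) :
    ∃ g : ℕ → ℕ → F, ∀ i j k l, ({i, j, k, l} : Multiset ℕ) ≤ d →
      T i j k l = g j l - g i l - g j k + g i k := by
  have swap2 : ∀ i j : ℕ, ({j, i} : Multiset ℕ) = {i, j} := fun i j => Multiset.cons_swap j i 0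
  -- The base letter depends only on the multiset `{i, j}`, so `h` stays skew in `i, j`.
  set h : ℕ → ℕ → ℕ → F := fun i j l => T i j (d - {i, j}).someElt l with h_def
  have hskew : ∀ i j l, h j i l = -h i j l := fun i j l => by
    rw [h_def]
    beta_reduce
    rw [swap2 i j, hs]
  have hii : ∀ i l, h i i l = 0 := fun i l => h0 _ _ _
  have hT : ∀ i j k l, ({i, j, k, l} : Multiset ℕ) ≤ d → T i j k l = h i j l - h i j k := by
    intro i j k l hd
    have hle : ({i, j} : Multiset ℕ) ≤ d := Multiset.le_of_count_le hd
    have hk : k ::ₘ {i, j} ≤ d := Multiset.le_of_count_le hd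
    have hl : l ::ₘ {i, j} ≤ d := Multiset.le_of_count_le hd
    have ho := Multiset.someElt_mem ((Multiset.mem_sub_iff_cons_le hle k).2 hk)
    rw [Multiset.mem_sub_iff_cons_le hle] at ho
    simp only [h_def]
    set o := (d - {i, j}).someElt
    by_cases hko : k = o
    · rw [← hko, h0']; simp
    by_cases hlo : l = o
    · rw [← hlo, h0', hs' i j k l]; simp
    by_cases hkl : k = l
    · rw [hkl, h0']; simp
    have h5 : ({o, k, l, i, j} : Multiset ℕ) ≤ d := Multiset.cons_cons_cons_le ho hk hl
      (Ne.symm hko) hkl (Ne.symm hlo)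
    have := hc' o k l i j h5
    rw [hs' i j o l] at this
    linear_combination this
  -- The cyclic sum of `h` does not depend on its last letter, by `hc`; `c` records the common
  -- value.
  set c : ℕ → ℕ → ℕ → F := fun i j k =>
    h i j (d - {i, j, k}).someElt + h j k (d - {i, j, k}).someElt
      + h k i (d - {i, j, k}).someElt with c_def
  have hc1 : ∀ i j k, c j i k = -c i j k := by
    intro i j k
    have : ({j, i, k} : Multiset ℕ) = {i, j, k} := Multiset.cons_swap _ _ _
    simp only [c_def, this]
    rw [hskew i j, hskew k i, hskew j k]
    ring
  have hc2 : ∀ i j k, c i k j = -c i j k := by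
    intro i j k
    have : ({i, k, j} : Multiset ℕ) = {i, j, k} := congrArg _ (Multiset.cons_swap _ _ _)
    simp only [c_def, this]
    rw [hskew i j, hskew k i, hskew j k]
    ring
  have hc0 : ∀ i j, c i i j = 0 := by
    intro i j
    simp only [c_def]
    rw [hii, hskew j i]
    ring
  have hch : ∀ i j k l, ({i, j, k, l} : Multiset ℕ) ≤ d →
      h i j l + h j k l + h k i l = c i j k := by
    intro i j k l hd
    have hle : ({i, j, k} : Multiset ℕ) ≤ d := Multiset.le_of_count_le hd
    have hl : l ::ₘ {i, j, k} ≤ d := Multiset.le_of_count_le hd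
    have ho := Multiset.someElt_mem ((Multiset.mem_sub_iff_cons_le hle l).2 hl)
    rw [Multiset.mem_sub_iff_cons_le hle] at ho
    simp only [c_def]
    set o := (d - {i, j, k}).someElt
    by_cases hlo : l = o
    · rw [← hlo]
    have h5 : ({l, o, i, j, k} : Multiset ℕ) ≤ d := Multiset.cons_cons_le hl ho hlo
    have h6 := hc i j k o l (Multiset.le_of_count_le h5)
    rw [hT i j o l (Multiset.le_of_count_le h5), hT j k o l (Multiset.le_of_count_le h5), hT k i o l (Multiset.le_of_count_le h5)] at h6
    linear_combination h6
  have hclosed : ∀ i j k l, ({i, j, k, l} : Multiset ℕ) ≤ d →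
      c j k l - c i k l + c i j l - c i j k = 0 := by
    intro i j k l hle
    -- A fifth letter makes closedness formal. When `d` is exactly `{i, j, k, l}`, the exchange
    -- symmetry `h4` replaces it.
    by_cases hm : ∃ m, m ∈ d - {i, j, k, l}
    · obtain ⟨m, hm⟩ := hm
      rw [Multiset.mem_sub_iff_cons_le hle] at hm
      rw [← hch j k l m (Multiset.le_of_count_le hm), ← hch i k l m (Multiset.le_of_count_le hm), ← hch i j l m (Multiset.le_of_count_le hm),
        ← hch i j k m (Multiset.le_of_count_le hm), hskew i k, hskew j l, hskew i l]
      ring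
    · have hd0 : d - {i, j, k, l} = 0 := Multiset.eq_zero_of_forall_notMem (by simpa using hm)
      have hd4 : card d = 4 := by
        have := congrArg card hd0
        rw [Multiset.card_sub hle] at this
        simp at this
        omega
      rw [← hch j k l i (Multiset.le_of_count_le hle), ← hch i k l j (Multiset.le_of_count_le hle), ← hch i j l k (Multiset.le_of_count_le hle),
        ← hch i j k l (Multiset.le_of_count_le hle)]
      have e1 := h4 hd4 i j k l (Multiset.le_of_count_le hle)
      have e2 := h4 hd4 i k j l (Multiset.le_of_count_le hle)
      have e3 := h4 hd4 i l j k (Multiset.le_of_count_le hle)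
      rw [hT i j k l (Multiset.le_of_count_le hle), hT k l i j (Multiset.le_of_count_le hle)] at e1
      rw [hT i k j l (Multiset.le_of_count_le hle), hT j l i k (Multiset.le_of_count_le hle)] at e2
      rw [hT i l j k (Multiset.le_of_count_le hle), hT j k i l (Multiset.le_of_count_le hle)] at e3
      rw [hskew i k, hskew j l]
      linear_combination e2 - e1 - e3 + hskew i l k - hskew i l j
  obtain ⟨o, ho⟩ : ∃ o, o ∈ d := Multiset.exists_mem_of_ne_zero (by
    rintro rfl
    simp at hd)
  -- The cone from `o` makes the closed `c` a coboundary.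
  have hca : ∀ i j k, ({i, j, k} : Multiset ℕ) ≤ d → i ≠ j → j ≠ k → i ≠ k →
      c i j k = c o i j + c o j k + c o k i := by
    intro i j k hle hij hjk hik
    by_cases hio : i = o
    · rw [hio, hc0, hc2 o o k, hc0]; simp
    by_cases hjo : j = o
    · rw [hjo, hc0, hc2 o o i, hc0, hc1 o i, hc2 o i k]; simp
    by_cases hko : k = o
    · rw [hko, hc0, hc2 o o j, hc0, hc2 i o j, hc1 o i]; simp
    have h4 : ({o, i, j, k} : Multiset ℕ) ≤ d := by
      refine Multiset.cons_le_of_mem_of_notMem ho ?_ hle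
      simp [Ne.symm hio, Ne.symm hjo, Ne.symm hko]
    have := hclosed o i j k h4
    rw [hc2 o i k]
    linear_combination this
  -- Subtracting that coboundary turns `h i j l`, for fixed `l`, into a cocycle in `i, j`. The
  -- correction is independent of `l`, so it cancels in `T i j k l = h i j l - h i j k`.
  have hg : ∀ l, ∃ g : ℕ → F, l ∈ d → ∀ i ∈ d - {l}, ∀ j ∈ d - {l}, h i j l - c o i j = g j - g i := by
    intro l
    by_cases hl : l ∈ d
    · have hl' : {l} ≤ d := Multiset.singleton_le.2 hl
      refine (fun ⟨g, hg⟩ => ⟨g, fun _ => hg⟩) <| exists_sub_eq_of_cocycle {i | i ∈ d - {l}} (fun i j => h i j l - c o i j) ?_ ?_ ?_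
      · intro i
        simp only [hii]
        rw [hc1 i o, ← hc2 i o i, hc1 i i o, hc0]; simp
      · intro i j
        simp only [hskew i j, hc2 o i j]; ring
      · intro i hi j hj k hk hij hjk hik
        rw [Set.mem_ofPred_eq, Multiset.mem_sub_iff_cons_le hl'] at hi hj hk
        have := Multiset.cons_cons_cons_le hi hj hk hij hjk hik
        have e1 := hca i j k (Multiset.le_of_count_le this) hij hjk hik
        rw [← hch i j k l (Multiset.le_of_count_le this)] at e1
        linear_combination e1
    · exact ⟨0, fun h => absurd h hl⟩
  choose g hg using hg
  refine ⟨fun i l => g l i, fun i j k l hle => ?_⟩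
  by_cases hij : i = j
  · rw [hij, h0]; ring
  have key : ∀ l, ({i, j, l} : Multiset ℕ) ≤ d → h i j l - c o i j = g l j - g l i := by
    intro l hle
    have hl' : {l} ≤ d := Multiset.le_of_count_le hle
    exact hg l (Multiset.singleton_le.1 hl') i ((Multiset.mem_sub_iff_cons_le hl' i).2 (Multiset.le_of_count_le hle)) j
      ((Multiset.mem_sub_iff_cons_le hl' j).2 (Multiset.le_of_count_le hle))
  rw [hT i j k l hle]
  linear_combination key l (Multiset.le_of_count_le hle) - key k (Multiset.le_of_count_le hle)

end Cocycle

/-! ### Centre-by-metabelian Lie algebras -/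

section CentreByMetabelian

variable {F Q : Type*} [Field F] [LieRing Q] [LieAlgebra F Q]

/-- The value of a bracketed word. -/
def FreeMagma.lieValue (x : ℕ → Q) : FreeMagma ℕ → Q
  | .of i => x i
  | .mul u v => ⁅FreeMagma.lieValue x u, FreeMagma.lieValue x v⁆

/-- The multiset of letters of a bracketed word. -/
def FreeMagma.letters : FreeMagma ℕ → Multiset ℕ
  | .of i => {i}
  | .mul u v => FreeMagma.letters u + FreeMagma.letters v

theorem FreeMagma.letters_ne_zero : ∀ w : FreeMagma ℕ, w.letters ≠ 0
  | .of i => Multiset.singleton_ne_zero i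
  | .mul u _ => fun h => letters_ne_zero u (_root_.add_eq_zero.1 h).1

/-- The iterated adjoint action of a list of variables. -/
def adList (x : ℕ → Q) (s : List ℕ) (u : Q) : Q := s.foldr (fun i v => ⁅x i, v⁆) u

@[simp] theorem adList_nil (x : ℕ → Q) (u : Q) : adList x [] u = u := rfl

@[simp] theorem adList_cons (x : ℕ → Q) (i : ℕ) (s : List ℕ) (u : Q) :
    adList x (i :: s) u = ⁅x i, adList x s u⁆ := rfl

theorem adList_append (x : ℕ → Q) (s t : List ℕ) (u : Q) :
    adList x (s ++ t) u = adList x s (adList x t u) := List.foldr_append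

theorem adList_zero (x : ℕ → Q) (s : List ℕ) : adList x s 0 = 0 := by
  induction s with
  | nil => rfl
  | cons i s ih => simp [ih]

theorem adList_neg (x : ℕ → Q) (s : List ℕ) (u : Q) : adList x s (-u) = -adList x s u := by
  induction s with
  | nil => rfl
  | cons i s ih => simp [ih]

theorem adList_add (x : ℕ → Q) (s : List ℕ) (u v : Q) :
    adList x s (u + v) = adList x s u + adList x s v := by
  induction s with
  | nil => rfl
  | cons i s ih => simp [ih]

theorem adList_bracket_eq_bracket (x : ℕ → Q) (s : List ℕ) (a b : Q) :
    ∃ p q : Q, adList x s ⁅a, b⁆ = ⁅p, q⁆ := by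
  cases s with
  | nil => exact ⟨a, b, rfl⟩
  | cons i s => exact ⟨x i, adList x s ⁅a, b⁆, rfl⟩

/-- The identity `[x, y, [z, t], u] = 0`. -/
def IsCentreByMetabelian (Q : Type*) [LieRing Q] : Prop :=
  ∀ a b c d e : Q, ⁅⁅⁅a, b⁆, ⁅c, d⁆⁆, e⁆ = 0

namespace IsCentreByMetabelian

/-! ### Moving letters in a product of two commutators -/

theorem lie_eq_zero (hQ : IsCentreByMetabelian Q) (a b c d e : Q) :
    ⁅e, ⁅⁅a, b⁆, ⁅c, d⁆⁆⁆ = 0 := by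
  rw [← lie_skew, hQ, neg_zero]

/-- The bracket of two commutators is central, so the derivation `ad y` kills it and `y` crosses
over with a sign. -/
theorem lie_lie_eq_neg (hQ : IsCentreByMetabelian Q) (y a b c d : Q) :
    ⁅⁅y, ⁅a, b⁆⁆, ⁅c, d⁆⁆ = -⁅⁅a, b⁆, ⁅y, ⁅c, d⁆⁆⁆ := by
  have h := leibniz_lie y ⁅a, b⁆ ⁅c, d⁆
  rw [hQ.lie_eq_zero] at h
  exact eq_neg_of_add_eq_zero_left h.symm

/-- Swapping two adjacent letters changes the left factor by a bracket of commutators, which is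
central. An outer letter is first moved to the other factor so that the induction hypothesis
applies. -/
theorem lie_adList_perm (hQ : IsCentreByMetabelian Q) (x : ℕ → Q) {s t : List ℕ} (h : s.Perm t)
    (a b c d : Q) : ⁅adList x s ⁅a, b⁆, ⁅c, d⁆⁆ = ⁅adList x t ⁅a, b⁆, ⁅c, d⁆⁆ := by
  induction h generalizing c d with
  | nil => rfl
  | @cons i s t _ ih =>
    obtain ⟨p, q, hpq⟩ := adList_bracket_eq_bracket x s a b
    obtain ⟨p', q', hpq'⟩ := adList_bracket_eq_bracket x t a b
    have := ih (x i) ⁅c, d⁆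
    rw [adList_cons, adList_cons, hpq, hpq', hQ.lie_lie_eq_neg, hQ.lie_lie_eq_neg, ← hpq, ← hpq',
      this]
  | swap i j s =>
    obtain ⟨p, q, hpq⟩ := adList_bracket_eq_bracket x s a b
    simp only [adList_cons]
    rw [leibniz_lie (x j), add_lie, hpq, hQ, zero_add]
  | trans _ _ ih1 ih2 => rw [ih1, ih2]

theorem lie_adList_adList (hQ : IsCentreByMetabelian Q) (x : ℕ → Q) (s t : List ℕ) (a b c d : Q) :
    ⁅adList x s ⁅a, b⁆, adList x t ⁅c, d⁆⁆ =
      (-1 : ℤ) ^ t.length • ⁅adList x (t ++ s) ⁅a, b⁆, ⁅c, d⁆⁆ := by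
  induction t generalizing s with
  | nil => simp
  | cons i t ih =>
    obtain ⟨p, q, hpq⟩ := adList_bracket_eq_bracket x s a b
    obtain ⟨p', q', hpq'⟩ := adList_bracket_eq_bracket x t c d
    have h := hQ.lie_lie_eq_neg (x i) p q p' q'
    rw [← hpq, ← hpq', ← adList_cons x i s, ← adList_cons x i t] at h
    rw [eq_neg_iff_add_eq_zero, add_comm, ← eq_neg_iff_add_eq_zero] at h
    rw [h, ih, List.length_cons, pow_succ, mul_neg_one, neg_smul,
      hQ.lie_adList_perm x (List.perm_middle : (t ++ i :: s).Perm (i :: (t ++ s)))]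
    rfl

theorem lie_adList_symm (hQ : IsCentreByMetabelian Q) (x : ℕ → Q) (s : List ℕ) (a b c d : Q) :
    ⁅adList x s ⁅c, d⁆, ⁅a, b⁆⁆ = -((-1 : ℤ) ^ s.length • ⁅adList x s ⁅a, b⁆, ⁅c, d⁆⁆) := by
  have h := hQ.lie_adList_adList x [] s a b c d
  rw [List.append_nil, adList_nil] at h
  rw [← h, lie_skew]

end IsCentreByMetabelian

/-! ### The two layers of a multidegree -/

variable (F) in
/-- The span of the commutators of two variables, under iterated adjoint action, with letters `d`. -/
def metaSpan (x : ℕ → Q) (d : Multiset ℕ) : Submodule F Q :=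
  Submodule.span F {u | ∃ (s : List ℕ) (i j : ℕ), ({i, j} : Multiset ℕ) + s = d ∧
    adList x s ⁅x i, x j⁆ = u}

variable (F) in
/-- The span of the brackets of two such commutators, with letters `d` in all. -/
def sqSpan (x : ℕ → Q) (d : Multiset ℕ) : Submodule F Q :=
  Submodule.span F {u | ∃ (s : List ℕ) (i j k l : ℕ), ({i, j, k, l} : Multiset ℕ) + s = d ∧
    ⁅adList x s ⁅x i, x j⁆, ⁅x k, x l⁆⁆ = u}

namespace IsCentreByMetabelian

theorem lie_sqSpan (hQ : IsCentreByMetabelian Q) (x : ℕ → Q) {d : Multiset ℕ} {v : Q}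
    (hv : v ∈ sqSpan F x d) (y : Q) : ⁅y, v⁆ = 0 := by
  induction hv using Submodule.span_induction with
  | mem v hv =>
    obtain ⟨s, i, j, k, l, -, rfl⟩ := hv
    obtain ⟨p, q, hpq⟩ := adList_bracket_eq_bracket x s (x i) (x j)
    rw [hpq, hQ.lie_eq_zero]
  | zero => exact lie_zero y
  | add u v _ _ hu hv => rw [lie_add, hu, hv, add_zero]
  | smul c u _ hu => rw [lie_smul, hu, smul_zero]

theorem sqSpan_lie (hQ : IsCentreByMetabelian Q) (x : ℕ → Q) {d : Multiset ℕ} {v : Q}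
    (hv : v ∈ sqSpan F x d) (y : Q) : ⁅v, y⁆ = 0 := by
  rw [← lie_skew, hQ.lie_sqSpan x hv, neg_zero]

theorem lie_mem_sqSpan (hQ : IsCentreByMetabelian Q) (x : ℕ → Q) {d e : Multiset ℕ} {u v : Q}
    (hu : u ∈ metaSpan F x d) (hv : v ∈ metaSpan F x e) : ⁅u, v⁆ ∈ sqSpan F x (d + e) := by
  induction hu, hv using Submodule.span_induction₂ with
  | mem_mem u v hu hv =>
    obtain ⟨s, i, j, rfl, rfl⟩ := hu
    obtain ⟨t, k, l, rfl, rfl⟩ := hv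
    rw [hQ.lie_adList_adList, ← Int.cast_smul_eq_zsmul F]
    refine Submodule.smul_mem _ _ (Submodule.subset_span ⟨_, _, _, _, _, ?_, rfl⟩)
    rw [← Multiset.coe_add]
    simp only [Multiset.insert_eq_cons, ← Multiset.singleton_add]
    abel
  | zero_left v hv => rw [zero_lie]; exact zero_mem _
  | zero_right u hu => rw [lie_zero]; exact zero_mem _
  | add_left u u' v _ _ _ h h' => rw [add_lie]; exact add_mem h h'
  | add_right u v v' _ _ _ h h' => rw [lie_add]; exact add_mem h h'
  | smul_left c u v _ _ h => rw [smul_lie]; exact Submodule.smul_mem _ _ h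
  | smul_right c u v _ _ h => rw [lie_smul]; exact Submodule.smul_mem _ _ h

end IsCentreByMetabelian

theorem lie_mem_metaSpan (x : ℕ → Q) {d : Multiset ℕ} {u : Q} (hu : u ∈ metaSpan F x d) (i : ℕ) :
    ⁅x i, u⁆ ∈ metaSpan F x ({i} + d) := by
  induction hu using Submodule.span_induction with
  | mem u hu =>
    obtain ⟨s, j, k, rfl, rfl⟩ := hu
    refine Submodule.subset_span ⟨i :: s, j, k, ?_, rfl⟩
    rw [← Multiset.cons_coe]
    simp only [Multiset.insert_eq_cons, ← Multiset.singleton_add]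
    abel
  | zero => rw [lie_zero]; exact zero_mem _
  | add u v _ _ hu hv => rw [lie_add]; exact add_mem hu hv
  | smul c u _ hu => rw [lie_smul]; exact Submodule.smul_mem _ _ hu

namespace IsCentreByMetabelian

-- By induction on the word: centrality of `sqSpan` leaves only brackets involving letters and
-- `metaSpan`.
variable (F) in
theorem lieValue_mem (hQ : IsCentreByMetabelian Q) (x : ℕ → Q) : ∀ w : FreeMagma ℕ,
    (∃ i, w = .of i) ∨ w.lieValue x ∈ metaSpan F x w.letters ⊔ sqSpan F x w.letters
  | .of i => Or.inl ⟨i, rfl⟩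
  | .mul u v => by
    right
    rw [FreeMagma.lieValue, FreeMagma.letters]
    rcases lieValue_mem hQ x u with ⟨i, rfl⟩ | hu <;> rcases lieValue_mem hQ x v with ⟨j, rfl⟩ | hv
    · refine Submodule.mem_sup_left (Submodule.subset_span ⟨[], i, j, ?_, rfl⟩)
      simp [FreeMagma.letters, Multiset.insert_eq_cons]
    · obtain ⟨p, hp, q, hq, hpq⟩ := Submodule.mem_sup.1 hv
      rw [← hpq, lie_add, hQ.lie_sqSpan x hq, add_zero]
      exact Submodule.mem_sup_left (lie_mem_metaSpan x hp i)
    · obtain ⟨p, hp, q, hq, hpq⟩ := Submodule.mem_sup.1 hu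
      rw [← hpq, add_lie, hQ.sqSpan_lie x hq, add_zero, ← lie_skew, add_comm]
      exact Submodule.mem_sup_left (neg_mem (lie_mem_metaSpan x hp j))
    · obtain ⟨p, hp, q, hq, hpq⟩ := Submodule.mem_sup.1 hu
      obtain ⟨p', hp', q', hq', hpq'⟩ := Submodule.mem_sup.1 hv
      rw [← hpq, ← hpq', add_lie, hQ.sqSpan_lie x hq, add_zero, lie_add, hQ.lie_sqSpan x hq',
        add_zero]
      exact Submodule.mem_sup_right (hQ.lie_mem_sqSpan x hp hp')

/-- An adjacent swap costs a bracket of two commutators, and any further letter kills that error. -/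
theorem adList_perm (hQ : IsCentreByMetabelian Q) (x : ℕ → Q) {s t : List ℕ} (h : s.Perm t)
    (i j : ℕ) (d : Multiset ℕ) (hd : ({i, j} : Multiset ℕ) + s = d) :
    adList x s ⁅x i, x j⁆ - adList x t ⁅x i, x j⁆ ∈ sqSpan F x d := by
  induction h generalizing d with
  | nil => simp
  | @cons k s t _ ih =>
    rw [adList_cons, adList_cons, ← lie_sub, hQ.lie_sqSpan x (ih _ rfl)]
    exact zero_mem _
  | swap k l s =>
    simp only [adList_cons]
    rw [leibniz_lie (x l), add_sub_cancel_right, ← lie_skew]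
    refine neg_mem (Submodule.subset_span ⟨s, i, j, l, k, ?_, rfl⟩)
    rw [← hd, ← Multiset.cons_coe, ← Multiset.cons_coe]
    simp only [Multiset.insert_eq_cons, ← Multiset.singleton_add]
    abel
  | @trans s t r hst _ ih1 ih2 =>
    rw [← sub_add_sub_cancel]
    exact add_mem (ih1 d hd) (ih2 d (by rw [← hd, Multiset.coe_eq_coe.2 hst]))

/-! ### Functionals on the two layers -/

theorem exists_sub_eq_of_sqSpan_le_ker (hQ : IsCentreByMetabelian Q) (x : ℕ → Q) (d : Multiset ℕ)
    (θ : Q →ₗ[F] F) (hθ : sqSpan F x d ≤ LinearMap.ker θ) :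
    ∃ g : ℕ → F, ∀ (s : List ℕ) (i j : ℕ), ({i, j} : Multiset ℕ) + s = d →
      θ (adList x s ⁅x i, x j⁆) = g j - g i := by
  set T : ℕ → ℕ → F := fun i j => θ (adList x (d - {i, j}).toList ⁅x i, x j⁆) with T_def
  have hT : ∀ (s : List ℕ) (i j : ℕ), ({i, j} : Multiset ℕ) + s = d →
      θ (adList x s ⁅x i, x j⁆) = T i j := by
    intro s i j hd
    have hs : s.Perm (d - {i, j}).toList := by
      rw [← Multiset.coe_eq_coe, Multiset.coe_toList, ← hd, add_tsub_cancel_left]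
    have := hθ (hQ.adList_perm x hs i j d hd)
    rwa [LinearMap.mem_ker, map_sub, sub_eq_zero] at this
  obtain ⟨g, hg⟩ := exists_sub_eq_of_cocycle {i | i ∈ d} T (fun i => by
      rw [T_def]
      beta_reduce
      rw [lie_self, adList_zero, map_zero]) (fun i j => by
      rw [T_def]
      beta_reduce
      rw [show ({j, i} : Multiset ℕ) = {i, j} from Multiset.cons_swap _ _ _, ← lie_skew,
        adList_neg, map_neg]) (by
      intro i hi j hj k hk hij hjk hik
      have hle : ({i, j, k} : Multiset ℕ) ≤ d :=
        Multiset.cons_le_of_mem_of_notMem hi (by simp [hij, hik])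
          (Multiset.cons_le_of_mem_of_notMem hj (by simp [hjk]) (Multiset.singleton_le.2 hk))
      obtain ⟨e, rfl⟩ := Multiset.le_iff_exists_add.1 hle
      -- The third letter is placed innermost, where the Jacobi identity applies.
      rw [← hT (e.toList ++ [k]) i j, ← hT (e.toList ++ [i]) j k, ← hT (e.toList ++ [j]) k i]
      · simp only [adList_append, adList_cons, adList_nil]
        rw [← map_add, ← map_add, ← adList_add, ← adList_add, lie_jacobi,
          adList_zero, map_zero]
      all_goals
        rw [← Multiset.coe_add, Multiset.coe_toList, Multiset.coe_singleton]
        simp only [Multiset.insert_eq_cons, ← Multiset.singleton_add]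
        abel)
  refine ⟨g, fun s i j hd => ?_⟩
  rw [hT s i j hd]
  exact hg i (by rw [← hd]; simp) j (by rw [← hd]; simp)

/-- The same `g` serves both formulas: the second is the first after exchanging the two pairs by
`lie_adList_symm`. -/
theorem exists_bilin_of_functional (hQ : IsCentreByMetabelian Q) (x : ℕ → Q) (d : Multiset ℕ)
    (hd : 4 ≤ Multiset.card d) (θ : Q →ₗ[F] F) :
    ∃ g : ℕ → ℕ → F, ∀ (s : List ℕ) (i j k l : ℕ), ({i, j, k, l} : Multiset ℕ) + s = d →
      θ ⁅adList x s ⁅x i, x j⁆, ⁅x k, x l⁆⁆ = g j l - g i l - g j k + g i k ∧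
      θ ⁅adList x s ⁅x i, x j⁆, ⁅x k, x l⁆⁆ =
        -(-1) ^ s.length * (g l j - g k j - g l i + g k i) := by
  set T : ℕ → ℕ → ℕ → ℕ → F := fun i j k l =>
    θ ⁅adList x (d - {i, j, k, l}).toList ⁅x i, x j⁆, ⁅x k, x l⁆⁆ with T_def
  have hT : ∀ (s : List ℕ) (i j k l : ℕ), ({i, j, k, l} : Multiset ℕ) + s = d →
      θ ⁅adList x s ⁅x i, x j⁆, ⁅x k, x l⁆⁆ = T i j k l := by
    intro s i j k l hd
    have hs : s.Perm (d - {i, j, k, l}).toList := by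
      rw [← Multiset.coe_eq_coe, Multiset.coe_toList, ← hd, add_tsub_cancel_left]
    rw [hQ.lie_adList_perm x hs]
  have hsymm : ∀ (s : List ℕ) (i j k l : ℕ), ({i, j, k, l} : Multiset ℕ) + s = d →
      T i j k l = -(-1) ^ s.length * T k l i j := by
    intro s i j k l hd
    rw [← hT s i j k l hd, ← hT s k l i j ?_, hQ.lie_adList_symm, map_neg, map_zsmul]
    · simp
    · rw [← hd]
      simp only [Multiset.insert_eq_cons, ← Multiset.singleton_add]
      abel
  have hc : ∀ i j k r s, ({i, j, k, r, s} : Multiset ℕ) ≤ d →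
      T i j r s + T j k r s + T k i r s = 0 := by
    intro i j k r s hle
    obtain ⟨e, rfl⟩ := Multiset.le_iff_exists_add.1 hle
    rw [← hT (e.toList ++ [k]) i j, ← hT (e.toList ++ [i]) j k, ← hT (e.toList ++ [j]) k i]
    · simp only [adList_append, adList_cons, adList_nil]
      rw [← map_add, ← map_add, ← add_lie, ← add_lie, ← adList_add, ← adList_add,
        lie_jacobi, adList_zero, zero_lie, map_zero]
    all_goals
      rw [← Multiset.coe_add, Multiset.coe_toList, Multiset.coe_singleton]
      simp only [Multiset.insert_eq_cons, ← Multiset.singleton_add]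
      abel
  obtain ⟨g, hg⟩ := exists_bilin_of_invariant_form d hd T
    (fun i k l => by simp only [T_def, lie_self, adList_zero, zero_lie, map_zero])
    (fun i j k => by simp only [T_def, lie_self, lie_zero, map_zero])
    (fun i j k l => by
      have : ({j, i, k, l} : Multiset ℕ) = {i, j, k, l} := Multiset.cons_swap _ _ _
      rw [T_def]
      beta_reduce
      rw [this, ← lie_skew (x j), adList_neg, neg_lie, map_neg])
    (fun i j k l => by
      have : ({i, j, l, k} : Multiset ℕ) = {i, j, k, l} := by
        simp only [Multiset.insert_eq_cons, ← Multiset.singleton_add]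
        abel
      rw [T_def]
      beta_reduce
      rw [this, ← lie_skew (x l), lie_neg, map_neg])
    (fun h4 i j k l hle => by
      have heq : ({k, l, i, j} : Multiset ℕ) + ([] : List ℕ) = d := by
        rw [Multiset.coe_nil, add_zero]
        refine Multiset.eq_of_le_of_card_le (Multiset.le_of_count_le hle) ?_
        simp [h4]
      simpa using hsymm [] k l i j heq)
    hc
    -- The cocycle law in the second pair follows from `hc` by exchange; the three terms carry the
    -- same sign because their lists have equal length.
    (fun i j k r s hle => by
      obtain ⟨e, rfl⟩ := Multiset.le_iff_exists_add.1 hle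
      have h := hc i j k r s hle
      rw [hsymm (k :: e.toList) r s i j, hsymm (i :: e.toList) r s j k,
        hsymm (j :: e.toList) r s k i]
      · simp only [List.length_cons]
        linear_combination -(-1) ^ (e.toList.length + 1) * h
      all_goals
        rw [← Multiset.cons_coe, Multiset.coe_toList]
        simp only [Multiset.insert_eq_cons, ← Multiset.singleton_add]
        abel)
  refine ⟨g, fun s i j k l hd => ?_⟩
  rw [hT s i j k l hd]
  refine ⟨hg i j k l ?_, ?_⟩
  · rw [← hd]
    exact Multiset.le_add_right _ _
  · rw [hsymm s i j k l hd, hg k l i j]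
    have : ({i, j, k, l} : Multiset ℕ) ≤ d := by
      rw [← hd]
      exact Multiset.le_add_right _ _
    exact Multiset.le_of_count_le this

end IsCentreByMetabelian

end CentreByMetabelian

/-! ### The algebra `M_{1,1}(E¹)` -/

namespace GrassmannOne

variable {F : Type*} [Field F]

/-! ### Supercommutativity of the Grassmann algebra -/

theorem ι_mul_ι_swap (u v : ℕ →₀ F) :
    ExteriorAlgebra.ι F u * ExteriorAlgebra.ι F v
      = -(ExteriorAlgebra.ι F v * ExteriorAlgebra.ι F u) :=
  eq_neg_of_add_eq_zero_left (ExteriorAlgebra.ι_add_mul_swap u v)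

theorem even_mul_ι {a : GrassmannOne F} (ha : a ∈ even F) (u : ℕ →₀ F) :
    a * ExteriorAlgebra.ι F u = ExteriorAlgebra.ι F u * a := by
  induction a, ha using CliffordAlgebra.even_induction with
  | algebraMap r => exact Algebra.commutes r _
  | add x y _ _ hx hy => rw [add_mul, mul_add, hx, hy]
  | ι_mul_ι_mul v w x _ hx =>
    change ExteriorAlgebra.ι F v * ExteriorAlgebra.ι F w * x * _ =
      _ * (ExteriorAlgebra.ι F v * ExteriorAlgebra.ι F w * x)
    rw [mul_assoc, hx, ← mul_assoc, ← mul_assoc, mul_assoc (ExteriorAlgebra.ι F v),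
      ι_mul_ι_swap w u, mul_neg, ← mul_assoc, ι_mul_ι_swap v u]
    simp only [neg_mul, neg_neg, mul_assoc]

theorem odd_mul_ι {a : GrassmannOne F} (ha : a ∈ odd F) (u : ℕ →₀ F) :
    a * ExteriorAlgebra.ι F u = -(ExteriorAlgebra.ι F u * a) := by
  induction a, ha using CliffordAlgebra.odd_induction with
  | ι v => exact ι_mul_ι_swap v u
  | add x y _ _ hx hy => rw [add_mul, mul_add, hx, hy, neg_add]
  | ι_mul_ι_mul v w x _ hx =>
    change ExteriorAlgebra.ι F v * ExteriorAlgebra.ι F w * x * _ =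
      -(_ * (ExteriorAlgebra.ι F v * ExteriorAlgebra.ι F w * x))
    rw [mul_assoc, hx, mul_neg, ← mul_assoc, mul_assoc (ExteriorAlgebra.ι F v),
      ι_mul_ι_swap w u, mul_neg, ← mul_assoc, ι_mul_ι_swap v u]
    simp only [neg_mul, neg_neg, mul_assoc]

theorem even_mul_comm {a : GrassmannOne F} (ha : a ∈ even F) (b : GrassmannOne F) :
    a * b = b * a := by
  induction b using ExteriorAlgebra.induction with
  | algebraMap r => exact (Algebra.commutes r _).symm
  | ι u => exact even_mul_ι ha u
  | mul x y hx hy => rw [← mul_assoc, hx, mul_assoc, hy, mul_assoc]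
  | add x y hx hy => rw [add_mul, mul_add, hx, hy]

theorem odd_mul_odd {a b : GrassmannOne F} (ha : a ∈ odd F) (hb : b ∈ odd F) :
    a * b = -(b * a) := by
  induction b, hb using CliffordAlgebra.odd_induction with
  | ι u => exact odd_mul_ι ha u
  | add x y _ _ hx hy => rw [add_mul, mul_add, hx, hy, neg_add]
  | ι_mul_ι_mul v w x _ hx =>
    change _ * (ExteriorAlgebra.ι F v * ExteriorAlgebra.ι F w * x) =
      -(ExteriorAlgebra.ι F v * ExteriorAlgebra.ι F w * x * _)
    have h : a * (ExteriorAlgebra.ι F v * ExteriorAlgebra.ι F w) =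
        ExteriorAlgebra.ι F v * ExteriorAlgebra.ι F w * a := by
      rw [← mul_assoc, odd_mul_ι ha, neg_mul, mul_assoc, odd_mul_ι ha, mul_neg, neg_neg, mul_assoc]
    rw [← mul_assoc, h, mul_assoc, hx, mul_neg, ← mul_assoc]

/-- A linear functional with prescribed values on the products of an even-numbered and an
odd-numbered generator. -/
theorem exists_functional (g : ℕ → ℕ → F) : ∃ G : GrassmannOne F →ₗ[F] F, ∀ i j : ℕ,
    G (ExteriorAlgebra.ι F (Finsupp.single (2 * i) 1) *
      ExteriorAlgebra.ι F (Finsupp.single (2 * j + 1) 1)) = g i j := by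
  -- Supported on (even, odd) index pairs, so antisymmetrising leaves only `g i j` on the required
  -- products.
  let γ : ℕ → ℕ → F := fun p q => if p % 2 = 0 ∧ q % 2 = 1 then g (p / 2) (q / 2) else 0
  let B : (ℕ →₀ F) →ₗ[F] (ℕ →₀ F) →ₗ[F] F :=
    Finsupp.linearCombination F fun p => Finsupp.linearCombination F (γ p)
  let f : (ℕ →₀ F) [⋀^Fin 2]→ₗ[F] F :=
    { toFun := fun v => B (v 0) (v 1) - B (v 1) (v 0)
      map_update_add' := fun v i x y => by
        fin_cases i <;> simp <;> ring
      map_update_smul' := fun v i c x => by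
        fin_cases i <;> simp <;> ring
      map_eq_zero_of_eq' := fun v i j h hij => by
        fin_cases i <;> fin_cases j <;> simp_all }
  have hB : ∀ p q, B (Finsupp.single p 1) (Finsupp.single q 1) = γ p q := by
    intro p q
    simp [B]
  refine ⟨ExteriorAlgebra.liftAlternating fun n => if h : n = 2 then h ▸ f else 0,
    fun i j => ?_⟩
  have := ExteriorAlgebra.liftAlternating_apply_ιMulti (R := F)
    (fun n => if h : n = 2 then h ▸ f else 0)
    ![Finsupp.single (2 * i) (1 : F), Finsupp.single (2 * j + 1) 1]
  rw [ExteriorAlgebra.ιMulti_apply] at this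
  simp only [List.ofFn_succ, List.ofFn_zero, List.prod_cons, List.prod_nil, mul_one] at this
  refine this.trans ?_
  change B (Finsupp.single (2 * i) 1) (Finsupp.single (2 * j + 1) 1) -
    B (Finsupp.single (2 * j + 1) 1) (Finsupp.single (2 * i) 1) = g i j
  rw [hB, hB]
  have h1 : (2 * j + 1) / 2 = j := by omega
  simp [γ, h1, Nat.add_mod]

end GrassmannOne

namespace M11

open GrassmannOne

variable {F : Type*} [Field F]

theorem lie_apply (A B : M11 F) (i j : Fin 2) : (⁅A, B⁆ : M11 F).1 i j =
    A.1 i 0 * B.1 0 j + A.1 i 1 * B.1 1 j - (B.1 i 0 * A.1 0 j + B.1 i 1 * A.1 1 j) := by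
  change (A.1 * B.1 - B.1 * A.1) i j = _
  simp [Matrix.mul_apply, Fin.sum_univ_two]

/-- The supertrace of a commutator vanishes: even entries commute and odd ones anticommute. -/
theorem lie_zero_zero_eq (A B : M11 F) : (⁅A, B⁆ : M11 F).1 0 0 = (⁅A, B⁆ : M11 F).1 1 1 := by
  rw [lie_apply, lie_apply, even_mul_comm A.2.1, even_mul_comm A.2.2.2.2,
    odd_mul_odd A.2.2.1 B.2.2.2.1, odd_mul_odd A.2.2.2.1 B.2.2.1]
  abel

theorem lie_apply_of_eq {A B : M11 F} (hA : A.1 0 0 = A.1 1 1) (hB : B.1 0 0 = B.1 1 1) :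
    (⁅A, B⁆ : M11 F).1 0 1 = 0 ∧ (⁅A, B⁆ : M11 F).1 1 0 = 0 := by
  constructor
  · rw [lie_apply, hA, hB, even_mul_comm A.2.2.2.2, even_mul_comm B.2.2.2.2]
    abel
  · rw [lie_apply, hA, hB, even_mul_comm A.2.2.2.2, even_mul_comm B.2.2.2.2]
    abel

/-- A bracket of two commutators is a scalar matrix with an even entry, hence central. -/
theorem isCentreByMetabelian : IsCentreByMetabelian (M11 F) := by
  intro a b c d e
  obtain ⟨h01, h10⟩ := lie_apply_of_eq (lie_zero_zero_eq a b) (lie_zero_zero_eq c d)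
  have h11 := lie_zero_zero_eq ⁅a, b⁆ ⁅c, d⁆
  set D : M11 F := ⁅⁅a, b⁆, ⁅c, d⁆⁆
  have hD := even_mul_comm D.2.2.2.2
  apply Subtype.ext
  ext i j
  rw [lie_apply]
  fin_cases i <;> fin_cases j <;> simp [h01, h10, h11, hD]

/-- The matrix with diagonal `1, -1` and two different generators off the diagonal. -/
noncomputable def generic (F : Type*) [Field F] (i : ℕ) : M11 F :=
  ⟨!![1, ExteriorAlgebra.ι F (Finsupp.single (2 * i) 1);
      ExteriorAlgebra.ι F (Finsupp.single (2 * i + 1) 1), -1],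
    by
      have h1 : (1 : GrassmannOne F) ∈ even F := by simpa using algebraMap_mem_even (1 : F)
      exact ⟨h1, CliffordAlgebra.ι_mem_evenOdd_one _ _, CliffordAlgebra.ι_mem_evenOdd_one _ _,
        neg_mem h1⟩⟩

/-- A commutator has equal diagonal entries, so only the diagonal `1, -1` of the outer generic
matrix affects its off-diagonal entries, scaling them by `2` and `-2`. -/
theorem adList_generic (s : List ℕ) (i j : ℕ) :
    (adList (generic F) s ⁅generic F i, generic F j⁆).1 0 1 =
      (2 : F) ^ (s.length + 1) • (ExteriorAlgebra.ι F (Finsupp.single (2 * j) 1) -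
        ExteriorAlgebra.ι F (Finsupp.single (2 * i) 1)) ∧
    (adList (generic F) s ⁅generic F i, generic F j⁆).1 1 0 =
      (-2 : F) ^ (s.length + 1) • (ExteriorAlgebra.ι F (Finsupp.single (2 * j + 1) 1) -
        ExteriorAlgebra.ι F (Finsupp.single (2 * i + 1) 1)) := by
  induction s with
  | nil =>
    rw [adList_nil, lie_apply, lie_apply]
    simp only [generic, Matrix.of_apply, Matrix.cons_val', Matrix.cons_val_zero,
      Matrix.cons_val_one, Matrix.cons_val_fin_one, List.length_nil, zero_add, pow_one,
      one_mul, mul_one, mul_neg, neg_mul]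
    constructor
    · rw [two_smul]; abel
    · rw [neg_smul, two_smul]; abel
  | cons k s ih =>
    obtain ⟨p, q, hpq⟩ := adList_bracket_eq_bracket (generic F) s (generic F i) (generic F j)
    have h := lie_zero_zero_eq p q
    rw [← hpq] at h
    set A := adList (generic F) s ⁅generic F i, generic F j⁆
    have hA := even_mul_comm A.2.2.2.2
    have e1 : (⁅generic F k, A⁆ : M11 F).1 0 1 = (2 : F) • A.1 0 1 := by
      rw [lie_apply, h, hA]
      simp only [generic, Matrix.of_apply, Matrix.cons_val', Matrix.cons_val_zero,
        Matrix.cons_val_one, Matrix.cons_val_fin_one, mul_neg, mul_one, one_mul]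
      rw [two_smul]; abel
    have e2 : (⁅generic F k, A⁆ : M11 F).1 1 0 = (-2 : F) • A.1 1 0 := by
      rw [lie_apply, h, hA]
      simp only [generic, Matrix.of_apply, Matrix.cons_val', Matrix.cons_val_zero,
        Matrix.cons_val_one, Matrix.cons_val_fin_one, mul_one, neg_mul, one_mul]
      rw [neg_smul, two_smul]; abel
    rw [adList_cons, e1, e2, ih.1, ih.2, smul_smul, smul_smul, ← pow_succ', ← pow_succ']
    exact ⟨rfl, rfl⟩

theorem lie_adList_generic_zero_one (s : List ℕ) (i j k l : ℕ) :
    (⁅adList (generic F) s ⁅generic F i, generic F j⁆, ⁅generic F k, generic F l⁆⁆ : M11 F).1 0 1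
      = 0 := by
  obtain ⟨p, q, hpq⟩ := adList_bracket_eq_bracket (generic F) s (generic F i) (generic F j)
  rw [hpq]
  exact (lie_apply_of_eq (lie_zero_zero_eq _ _) (lie_zero_zero_eq _ _)).1

theorem functional_lie_adList_generic {g : ℕ → ℕ → F} {G : GrassmannOne F →ₗ[F] F}
    (hG : ∀ i j : ℕ, G (ExteriorAlgebra.ι F (Finsupp.single (2 * i) 1) *
      ExteriorAlgebra.ι F (Finsupp.single (2 * j + 1) 1)) = g i j) (s : List ℕ) (i j k l : ℕ) :
    G ((⁅adList (generic F) s ⁅generic F i, generic F j⁆,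
        ⁅generic F k, generic F l⁆⁆ : M11 F).1 0 0) =
      -2 ^ (s.length + 2) * ((g j l - g i l - g j k + g i k)
        - (-1) ^ s.length * (g l j - g k j - g l i + g k i)) := by
  obtain ⟨h1, h2⟩ := adList_generic (F := F) s i j
  obtain ⟨h3, h4⟩ := adList_generic (F := F) [] k l
  rw [adList_nil] at h3 h4
  rw [lie_apply, h1, h2, h3, h4, even_mul_comm (adList _ s _ : M11 F).2.1]
  simp only [smul_mul_smul_comm, sub_mul, mul_sub, map_sub, map_add, map_smul, hG, smul_eq_mul,
    List.length_nil]
  have : (-2 : F) ^ (s.length + 1) = -(2 ^ (s.length + 1) * (-1) ^ s.length) := by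
    rw [neg_pow]; ring
  rw [this]
  ring

end M11

/-! ### Detecting zero by the generic substitution -/

section Detection

variable {F Q : Type*} [Field F] [LieRing Q] [LieAlgebra F Q]

theorem LieHom.map_adList {L : Type*} [LieRing L] [LieAlgebra F L] (ψ : Q →ₗ⁅F⁆ L) (x : ℕ → Q)
    (y : ℕ → L) (hψ : ∀ i, ψ (x i) = y i) (s : List ℕ) (u : Q) :
    ψ (adList x s u) = adList y s (ψ u) := by
  induction s with
  | nil => rfl
  | cons i s ih => rw [adList_cons, adList_cons, LieHom.map_lie, ih, hψ]

namespace IsCentreByMetabelian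

variable {x : ℕ → Q} {ψ : Q →ₗ⁅F⁆ M11 F}

theorem entry_zero_one_of_mem_sqSpan (hψ : ∀ i, ψ (x i) = M11.generic F i) {d : Multiset ℕ} {v : Q}
    (hv : v ∈ sqSpan F x d) : (ψ v).1 0 1 = 0 := by
  induction hv using Submodule.span_induction with
  | mem v hv =>
    obtain ⟨s, i, j, k, l, -, rfl⟩ := hv
    rw [LieHom.map_lie, LieHom.map_lie, ψ.map_adList x _ hψ, LieHom.map_lie, hψ, hψ, hψ, hψ]
    exact M11.lie_adList_generic_zero_one s i j k l
  | zero => simp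
  | add u v _ _ hu hv => simp [hu, hv]
  | smul c u _ hu => simp [hu]

theorem mem_sqSpan_of_mem_metaSpan (hQ : IsCentreByMetabelian Q) (h2 : (2 : F) ≠ 0)
    (hψ : ∀ i, ψ (x i) = M11.generic F i) {d : Multiset ℕ} {u : Q} (hu : u ∈ metaSpan F x d)
    (h0 : (ψ u).1 0 1 = 0) : u ∈ sqSpan F x d := by
  by_contra hnot
  obtain ⟨θ, hθu, hθ⟩ := Submodule.exists_le_ker_of_notMem hnot
  obtain ⟨g, hg⟩ := hQ.exists_sub_eq_of_sqSpan_le_ker x d θ hθ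
  -- Reads the degree-one part; `p / 2` recovers `i` from the index `2 * i`.
  let G : GrassmannOne F →ₗ[F] F :=
    (Finsupp.linearCombination F fun p => g (p / 2)) ∘ₗ ExteriorAlgebra.ιInv
  have hG : ∀ i : ℕ, G (ExteriorAlgebra.ι F (Finsupp.single (2 * i) 1)) = g i := by
    intro i
    simp [G, ExteriorAlgebra.ι_leftInverse _]
  have key : ∀ v ∈ metaSpan F x d, G ((ψ v).1 0 1) = 2 ^ (Multiset.card d - 1) * θ v := by
    intro v hv
    induction hv using Submodule.span_induction with
    | mem v hv =>
      obtain ⟨s, i, j, hd, rfl⟩ := hv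
      have hn : Multiset.card d - 1 = s.length + 1 := by
        rw [← hd]; simp
      rw [hg s i j hd, ψ.map_adList x _ hψ, LieHom.map_lie, hψ, hψ, (M11.adList_generic s i j).1,
        map_smul, map_sub, hG, hG, hn, smul_eq_mul]
    | zero => simp
    | add u v _ _ hu hv => simp [hu, hv, mul_add]
    | smul c u _ hu => simp [hu]; ring
  have := key u hu
  rw [h0, map_zero, eq_comm, mul_eq_zero] at this
  exact this.elim (pow_ne_zero _ h2) hθu

theorem eq_zero_of_mem_sqSpan (hQ : IsCentreByMetabelian Q) (h2 : (2 : F) ≠ 0)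
    (hψ : ∀ i, ψ (x i) = M11.generic F i) {d : Multiset ℕ} {v : Q} (hv : v ∈ sqSpan F x d)
    (h0 : (ψ v).1 0 0 = 0) : v = 0 := by
  by_cases hd : 4 ≤ Multiset.card d
  -- With fewer than four letters there are no spanning products.
  swap
  · have : sqSpan F x d = ⊥ := by
      rw [sqSpan, Submodule.span_eq_bot]
      rintro _ ⟨s, i, j, k, l, rfl, -⟩
      exact absurd (by simp) hd
    rwa [this, Submodule.mem_bot] at hv
  by_contra hnot
  obtain ⟨θ, hθv, -⟩ := Submodule.exists_le_ker_of_notMem (K := F) (p := ⊥) (v := v) (by simpa)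
  obtain ⟨g, hg⟩ := hQ.exists_bilin_of_functional x d hd θ
  obtain ⟨G, hG⟩ := GrassmannOne.exists_functional g
  have key : ∀ u ∈ sqSpan F x d, G ((ψ u).1 0 0) = -2 ^ (Multiset.card d - 1) * θ u := by
    intro u hu
    induction hu using Submodule.span_induction with
    | mem u hu =>
      obtain ⟨s, i, j, k, l, hd, rfl⟩ := hu
      obtain ⟨e1, e2⟩ := hg s i j k l hd
      have hn : Multiset.card d - 1 = s.length + 3 := by
        rw [← hd]; simp
      rw [LieHom.map_lie, LieHom.map_lie, ψ.map_adList x _ hψ, LieHom.map_lie, hψ, hψ, hψ, hψ,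
        M11.functional_lie_adList_generic hG, ← e1, hn]
      -- The two expressions for `θ` add up to `2 * θ`, which gives the extra factor 2.
      linear_combination (2 : F) ^ (s.length + 2) * e2
    | zero => simp
    | add u v _ _ hu hv => simp [hu, hv, mul_add]
    | smul c u _ hu => simp [hu]; ring
  have := key v hv
  rw [h0, map_zero, eq_comm, mul_eq_zero] at this
  exact this.elim (neg_ne_zero.2 (pow_ne_zero _ h2)) hθv

/-- A multihomogeneous element of a centre-by-metabelian Lie algebra is zero if it vanishes under
the generic substitution into `M_{1,1}(E¹)`. -/
theorem eq_zero_of_generic (hQ : IsCentreByMetabelian Q) (h2 : (2 : F) ≠ 0)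
    (hψ : ∀ i, ψ (x i) = M11.generic F i) {d : Multiset ℕ} {f : Q}
    (hf : f ∈ Submodule.span F (FreeMagma.lieValue x '' {w | w.letters = d})) (h0 : ψ f = 0) :
    f = 0 := by
  -- A lone variable lies in neither layer; its coefficient is read from the diagonal entry 1.
  by_cases hd : ∃ i, d = {i}
  · obtain ⟨i, rfl⟩ := hd
    have hx : f ∈ Submodule.span F {x i} := by
      refine Submodule.span_mono ?_ hf
      rintro _ ⟨w, hw, rfl⟩
      cases w with
      | of j => rw [Multiset.singleton_inj.1 hw]; rfl
      | mul u v =>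
        have := congrArg Multiset.card hw
        have hu := Multiset.card_pos.2 u.letters_ne_zero
        have hv := Multiset.card_pos.2 v.letters_ne_zero
        rw [FreeMagma.letters, Multiset.card_add, Multiset.card_singleton] at this
        omega
    obtain ⟨c, rfl⟩ := Submodule.mem_span_singleton.1 hx
    rw [map_smul, hψ] at h0
    have h1 : (c • M11.generic F i).1 0 0 = 0 := by rw [h0]; rfl
    have h2 : c • (1 : GrassmannOne F) = 0 := h1
    rw [(smul_eq_zero.1 h2).resolve_right one_ne_zero, zero_smul]
  · have hf' : f ∈ metaSpan F x d ⊔ sqSpan F x d := by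
      refine Submodule.span_le.2 ?_ hf
      rintro _ ⟨w, rfl, rfl⟩
      exact (hQ.lieValue_mem F x w).resolve_left fun ⟨i, hi⟩ => hd ⟨i, by rw [hi]; rfl⟩
    obtain ⟨u, hu, v, hv, rfl⟩ := Submodule.mem_sup.1 hf'
    have hu' : u ∈ sqSpan F x d := by
      refine hQ.mem_sqSpan_of_mem_metaSpan h2 hψ hu ?_
      have h1 : (ψ (u + v)).1 0 1 = 0 := by rw [h0]; rfl
      have h2 := entry_zero_one_of_mem_sqSpan hψ hv
      simpa [h2] using h1
    exact hQ.eq_zero_of_mem_sqSpan h2 hψ (add_mem hu' hv) (by rw [h0]; rfl)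

end IsCentreByMetabelian

end Detection

/-! ### Consequences of the centre-by-metabelian identity -/

namespace LiePoly

variable {F : Type*} [Field F]

theorem toMultiset_multidegree : ∀ w : FreeMagma ℕ, (multidegree w).toMultiset = w.letters
  | .of i => by
    change Finsupp.toMultiset (Finsupp.single i 1) = _
    rw [Finsupp.toMultiset_single, one_smul]
    rfl
  | .mul u v => by
    change Finsupp.toMultiset (multidegree u + multidegree v) = _
    rw [map_add, toMultiset_multidegree u, toMultiset_multidegree v]
    rfl

theorem lift_centreByMetabelian {L : Type*} [LieRing L] [LieAlgebra F L] (a : ℕ → L) :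
    FreeLieAlgebra.lift F a (centreByMetabelian F) = ⁅⁅⁅a 0, a 1⁆, ⁅a 2, a 3⁆⁆, a 4⁆ := by
  simp only [centreByMetabelian, LieHom.map_lie, FreeLieAlgebra.lift_of_apply]

theorem mk_monomial (I : LieIdeal F (LiePoly F)) : ∀ w : FreeMagma ℕ,
    LieSubmodule.Quotient.mk' I (monomial F w) =
      w.lieValue fun i => LieSubmodule.Quotient.mk' I (FreeLieAlgebra.of F i)
  | .of _ => rfl
  | .mul u v => by
    rw [monomial, FreeMagma.lieValue, ← mk_monomial I u, ← mk_monomial I v]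
    exact LieSubmodule.Quotient.mk_bracket (I := I) _ _

theorem isCentreByMetabelian_quotient :
    IsCentreByMetabelian (LiePoly F ⧸ tIdeal (centreByMetabelian F)) := by
  intro a b c d e
  obtain ⟨a, rfl⟩ := LieSubmodule.Quotient.surjective_mk' _ a
  obtain ⟨b, rfl⟩ := LieSubmodule.Quotient.surjective_mk' _ b
  obtain ⟨c, rfl⟩ := LieSubmodule.Quotient.surjective_mk' _ c
  obtain ⟨d, rfl⟩ := LieSubmodule.Quotient.surjective_mk' _ d
  obtain ⟨e, rfl⟩ := LieSubmodule.Quotient.surjective_mk' _ e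
  have h : ⁅⁅⁅a, b⁆, ⁅c, d⁆⁆, e⁆ ∈ tIdeal (centreByMetabelian F) := by
    refine LieSubmodule.subset_lieSpan ⟨fun n => if n = 0 then a else if n = 1 then b else
      if n = 2 then c else if n = 3 then d else e, ?_⟩
    simp [lift_centreByMetabelian]
  exact (LieSubmodule.Quotient.mk_eq_zero _).2 h

theorem tIdeal_le_ker {L : Type*} [LieRing L] [LieAlgebra F L] (hL : IsCentreByMetabelian L)
    (φ : LiePoly F →ₗ⁅F⁆ L) : tIdeal (centreByMetabelian F) ≤ φ.ker := by
  refine LieSubmodule.lieSpan_le.2 ?_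
  rintro _ ⟨s, rfl⟩
  change _ ∈ φ.ker
  beta_reduce
  rw [LieHom.mem_ker, lift_centreByMetabelian]
  simp only [LieHom.map_lie]
  exact hL _ _ _ _ _

/-- The homomorphism induced on the quotient by the consequences of the centre-by-metabelian
identity. -/
noncomputable def quotientLift {L : Type*} [LieRing L] [LieAlgebra F L]
    (hL : IsCentreByMetabelian L) (φ : LiePoly F →ₗ⁅F⁆ L) :
    (LiePoly F ⧸ tIdeal (centreByMetabelian F)) →ₗ⁅F⁆ L :=
  { (tIdeal (centreByMetabelian F)).toSubmodule.liftQ (φ : LiePoly F →ₗ[F] L)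
      (fun _ hx => tIdeal_le_ker hL φ hx) with
    map_lie' := by
      intro a b
      obtain ⟨a, rfl⟩ := LieSubmodule.Quotient.surjective_mk' _ a
      obtain ⟨b, rfl⟩ := LieSubmodule.Quotient.surjective_mk' _ b
      exact φ.map_lie a b }

end LiePoly

theorem proposition2 (F : Type*) [Field F] (hF : ringChar F ≠ 2) (f : LiePoly F)
    (hmulti : f.IsMultihomogeneous) (hid : f.IsIdentity (M11 F)) :
    f.IsConsequenceOf (LiePoly.centreByMetabelian F) := by
  obtain ⟨d, hd⟩ := hmulti
  let I := LiePoly.tIdeal (LiePoly.centreByMetabelian F)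
  let φ := FreeLieAlgebra.lift F (M11.generic F)
  have hψ : ∀ y : LiePoly F, LiePoly.quotientLift M11.isCentreByMetabelian φ
      (LieSubmodule.Quotient.mk' I y) = φ y := fun _ => rfl
  -- Being a consequence means vanishing in the quotient, where the identity is used only at the
  -- generic matrices.
  refine (LieSubmodule.Quotient.mk_eq_zero I).1 ?_
  refine LiePoly.isCentreByMetabelian_quotient.eq_zero_of_generic (Ring.two_ne_zero hF)
    (x := fun i => LieSubmodule.Quotient.mk' I (FreeLieAlgebra.of F i))
    (ψ := LiePoly.quotientLift M11.isCentreByMetabelian φ) (d := d.toMultiset)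
    (fun i => (hψ _).trans (FreeLieAlgebra.lift_of_apply _ i)) ?_ ((hψ f).trans (hid _))
  have h := Submodule.mem_map_of_mem (f := (LieSubmodule.Quotient.mk' I : LiePoly F →ₗ[F] LiePoly F ⧸ I)) hd
  rw [Submodule.map_span] at h
  refine Submodule.span_mono ?_ h
  rintro _ ⟨_, ⟨w, rfl, rfl⟩, rfl⟩
  exact ⟨w, (LiePoly.toMultiset_multidegree w).symm, (LiePoly.mk_monomial I w).symm⟩
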